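/- **Theorem 1.** For every $\varepsilon\in(0,\frac12)$ there is an $n_0=n_0(\varepsilon)$ such that the following holds for every integer $n>n_0$. Let $G=G(A,B)$ and $H=H(S,T)$ be simple bipartite graphs with vertex classes $A,B$ and $S,T$, respectively, where $|A|=|B|=|S|=|T|=n$. Suppose that 1. $d_G(x)>\left(\frac12+\varepsilon\right)n$ for all $x\in A\cup B$, 2. $d_H(x)<\frac{\varepsilon^4}{100}\cdot\frac{n}{\log n}$ for all $x\in S$ (where $\log$ is the natural logarithm), 3. $d_H(y)=1$ for all $y\in T$. Then $H\subseteq G$: there is an injective map from $S\cup T$ to $A\cup B$ that takes $S$ to $A$, $T$ to $B$ and every edge of $H$ to an edge of $G$. Equivalently, $H$ and the bipartite complement $\overline G$ of $G$ (with classes $A,B$, in which $a\in A$ and $b\in B$ are adjacent if and only if $ab$ is not an edge of $G$) pack in the bipartite sense: the complete bipartite graph $K_{n,n}$ contains edge-disjoint copies of $H$ and $\overline G$, with $S$ and $A$ placed in the first class and $T$ and $B$ in the second. -/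

import Mathlib

namespace BipartitePacking

universe u v

/-- `G(A, B)`: the simple graph `G` is bipartite with vertex classes `A` and `B`, that is,
`A` and `B` are disjoint, every edge joins `A` to `B`, and `A ∪ B` is the whole vertex set. -/
def IsBigraph {V : Type u} (G : SimpleGraph V) (A B : Finset V) : Prop :=
  G.IsBipartiteWith (A : Set V) (B : Set V) ∧ (A : Set V) ∪ (B : Set V) = Set.univ

/-- The complement of `G(A, B)` in the complete bipartite graph with classes `A` and `B`. -/
def bipartiteCompl {V : Type u} (G : SimpleGraph V) (A B : Finset V) : SimpleGraph V :=
  SimpleGraph.fromRel (fun x y => x ∈ A ∧ y ∈ B) \ G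

/-- `H(S, T)` is a subgraph of `G(A, B)`: there is a copy of `H` in `G` (an injective map of the
vertices sending edges to edges) that takes `S` into `A` and `T` into `B`. -/
def IsBipartiteSubgraph {V : Type u} {W : Type v} (H : SimpleGraph W) (S T : Finset W)
    (G : SimpleGraph V) (A B : Finset V) : Prop :=
  ∃ f : SimpleGraph.Copy H G, (∀ s ∈ S, f s ∈ A) ∧ (∀ t ∈ T, f t ∈ B)

/-- The bipartite graphs `G₁(A, B)` and `G₂(S, T)`, with `|A| = |S| = m` and `|B| = |T| = n`,
pack in the bipartite sense: the complete bipartite graph `K_{m,n}` contains edge-disjoint copies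
of them, placed with `A`, `S` in the class of size `m` and `B`, `T` in the class of size `n`. -/
def BipartitePack {V : Type u} {W : Type v} (G₁ : SimpleGraph V) (A B : Finset V)
    (G₂ : SimpleGraph W) (S T : Finset W) (m n : ℕ) : Prop :=
  ∃ (f : SimpleGraph.Copy G₁ (completeBipartiteGraph (Fin m) (Fin n)))
    (g : SimpleGraph.Copy G₂ (completeBipartiteGraph (Fin m) (Fin n))),
    (∀ a ∈ A, (f a).isLeft) ∧ (∀ b ∈ B, (f b).isRight) ∧
    (∀ s ∈ S, (g s).isLeft) ∧ (∀ t ∈ T, (g t).isRight) ∧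
    ∀ x y x' y', G₁.Adj x y → G₂.Adj x' y' → s(f x, f y) ≠ s(g x', g y')

end BipartitePacking

/-!
Place `S` on `A` by a uniformly random bijection `φ`. For `b ∈ B`, let `M b ⊆ A` be the set of
non-neighbours of `b`, of density at most `1 / 2 - ε`, and weight each `s ∈ S` by its degree in
`H`. The events `φ s ∈ M b` are negatively correlated, so the weight that `φ` puts on `M b` obeys
the Chernoff bound for independent events. Since every weight is `O(n / log n)` and the total is
at most `n`, a union bound over `B` yields a `φ` that puts at most half of the total on every
`M b`. For such a `φ`, join `t ∈ T` to the `b ∈ B` that are adjacent in `G` to the image of the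
neighbour of `t`: all degrees of this auxiliary bipartite graph are at least `n / 2`, so Hall's
theorem places `T` on `B`.
-/

namespace BipartitePacking

open Finset
open scoped BigOperators

section RandomBijection

variable {S A : Type*} [Fintype S] [DecidableEq S] [DecidableEq A] {X Y : Finset S}

theorem card_filter_compl_apply_mem {M : Finset A} {φ : S ≃ A} (hφ : ∀ x ∈ X, φ x ∈ M) :
    #{t ∈ Xᶜ | φ t ∈ M} = #M - #X := by
  have hpre : {t ∈ Xᶜ | φ t ∈ M} = M.map φ.symm.toEmbedding \ X := by
    ext t
    simp [and_comm]
  have hX : X ⊆ M.map φ.symm.toEmbedding := fun x hx =>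
    mem_map.2 ⟨φ x, hφ x hx, φ.symm_apply_apply x⟩
  rw [hpre, card_sdiff_of_subset hX, card_map]

variable [Fintype A]

theorem card_equiv_forall_mem_eq_of_card_eq (M : Finset A) (h : #X = #Y) :
    #{φ : S ≃ A | ∀ x ∈ X, φ x ∈ M} = #{φ : S ≃ A | ∀ y ∈ Y, φ y ∈ M} := by
  let σ : Equiv.Perm S := (equivOfCardEq h).extendSubtype
  have hσ : ∀ x, x ∈ X ↔ σ x ∈ Y := fun x =>
    ⟨(equivOfCardEq h).extendSubtype_mem x, fun hx => by
      by_contra hX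
      exact (equivOfCardEq h).extendSubtype_not_mem x hX hx⟩
  refine card_equiv (σ.equivCongr (Equiv.refl A)) fun φ => ?_
  simp only [mem_filter_univ, hσ]
  exact σ.forall_congr fun x => by simp

-- Both sides count the pairs of a bijection sending `X` into `M` and a further point sent into `M`.
theorem card_sub_mul_card_equiv_forall_mem_insert (M : Finset A) {s : S} (hs : s ∉ X) :
    (#M - #X) * #{φ : S ≃ A | ∀ x ∈ X, φ x ∈ M} =
      (Fintype.card S - #X) * #{φ : S ≃ A | ∀ x ∈ insert s X, φ x ∈ M} := by
  rw [← card_compl, mul_comm]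
  refine card_mul_eq_card_mul (fun (φ : S ≃ A) t => φ t ∈ M)
    (fun φ hφ => card_filter_compl_apply_mem (mem_filter_univ φ |>.1 hφ)) fun t ht => ?_
  have hcard : #(insert t X) = #(insert s X) := by
    rw [card_insert_of_notMem (mem_compl.1 ht), card_insert_of_notMem hs]
  rw [← card_equiv_forall_mem_eq_of_card_eq M hcard, bipartiteBelow, filter_filter]
  simp only [forall_mem_insert, and_comm]

theorem dens_equiv_forall_mem_insert_le (M : Finset A) {s : S} (hs : s ∉ X) :
    dens {φ : S ≃ A | ∀ x ∈ insert s X, φ x ∈ M} ≤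
      M.dens * dens {φ : S ≃ A | ∀ x ∈ X, φ x ∈ M} := by
  rcases isEmpty_or_nonempty (S ≃ A) with _ | ⟨⟨φ₀⟩⟩
  · simp [univ_eq_empty]
  have hSA : Fintype.card S = Fintype.card A := Fintype.card_congr φ₀
  have hMS : #M ≤ Fintype.card S := hSA ▸ card_le_univ M
  have hXS : #X < Fintype.card S := (card_lt_iff_ne_univ X).2 fun h => hs (h ▸ mem_univ s)
  have hpairs := card_sub_mul_card_equiv_forall_mem_insert M hs
  set P := #{φ : S ≃ A | ∀ x ∈ insert s X, φ x ∈ M} with hP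
  set Q := #{φ : S ≃ A | ∀ x ∈ X, φ x ∈ M} with hQ
  have hratio : Fintype.card S * (#M - #X) ≤ #M * (Fintype.card S - #X) := by
    rw [Nat.mul_sub, Nat.mul_sub, mul_comm #M]
    gcongr
  have hcount : Fintype.card S * P ≤ #M * Q := by
    refine le_of_mul_le_mul_left ?_ (Nat.sub_pos_of_lt hXS)
    calc (Fintype.card S - #X) * (Fintype.card S * P)
        = Fintype.card S * (#M - #X) * Q := by rw [mul_assoc, hpairs, mul_left_comm]
      _ ≤ #M * (Fintype.card S - #X) * Q := by gcongr
      _ = (Fintype.card S - #X) * (#M * Q) := by ring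
  have hA : (0 : ℚ≥0) < Fintype.card A := by exact_mod_cast hSA ▸ hXS.pos
  rw [dens_eq_card_div_card, dens_eq_card_div_card, dens_eq_card_div_card, ← hP, ← hQ,
    ← mul_div_assoc]
  gcongr
  rw [div_mul_eq_mul_div, le_div_iff₀ hA, mul_comm, ← hSA]
  exact_mod_cast hcount

theorem dens_equiv_forall_mem_le (M : Finset A) (X : Finset S) :
    dens {φ : S ≃ A | ∀ x ∈ X, φ x ∈ M} ≤ M.dens ^ #X := by
  induction X using Finset.induction_on with
  | empty => simp
  | insert s X hs ih =>
    rw [card_insert_of_notMem hs, pow_succ']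
    exact (dens_equiv_forall_mem_insert_le M hs).trans (by gcongr)

theorem expect_equiv_prod_one_add_le (M : Finset A) {c : S → ℝ} (hc : ∀ s, 0 ≤ c s) :
    𝔼 φ : S ≃ A, ∏ s, (1 + if φ s ∈ M then c s else 0) ≤ ∏ s, (1 + c s * M.dens) := by
  simp only [prod_one_add]
  rw [expect_sum_comm]
  refine sum_le_sum fun X _ => ?_
  calc 𝔼 φ : S ≃ A, ∏ s ∈ X, (if φ s ∈ M then c s else 0)
      = (∏ s ∈ X, c s) * dens {φ : S ≃ A | ∀ x ∈ X, φ x ∈ M} := by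
        have hind : ∀ φ : S ≃ A, (∏ s ∈ X, if φ s ∈ M then c s else 0) =
            if ∀ s ∈ X, φ s ∈ M then ∏ s ∈ X, c s else 0 := fun φ => by convert prod_ite_zero
        simp only [hind]
        rw [Fintype.expect_eq_sum_div_card, ← sum_filter, sum_const, nsmul_eq_mul, nnratCast_dens,
          mul_comm, mul_div_assoc]
    _ ≤ (∏ s ∈ X, c s) * (M.dens : ℝ) ^ #X := by
        gcongr
        · exact prod_nonneg fun s _ => hc s
        · exact_mod_cast dens_equiv_forall_mem_le M X
    _ = ∏ s ∈ X, c s * (M.dens : ℝ) := by rw [prod_mul_distrib, prod_const]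

theorem exp_sub_one_le_one_add_mul {x δ : ℝ} (hx : 0 ≤ x) (hxδ : x ≤ δ) (hδ : δ ≤ 1) :
    Real.exp x - 1 ≤ (1 + δ) * x := by
  have hquad := Real.abs_exp_sub_one_sub_id_le (x := x) (by rw [abs_of_nonneg hx]; linarith)
  nlinarith [(abs_le.1 hquad).2]

theorem expect_equiv_exp_sum_le (M : Finset A) {w : S → ℝ} {δ : ℝ} (hδ : δ ≤ 1)
    (hw : ∀ s, 0 ≤ w s) (hwδ : ∀ s, w s ≤ δ) :
    𝔼 φ : S ≃ A, Real.exp (∑ s with φ s ∈ M, w s) ≤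
      Real.exp (M.dens * ((1 + δ) * ∑ s, w s)) := by
  have hexp : ∀ s, 0 ≤ Real.exp (w s) - 1 := fun s => sub_nonneg.2 (Real.one_le_exp (hw s))
  have hprod : ∀ φ : S ≃ A, Real.exp (∑ s with φ s ∈ M, w s) =
      ∏ s, (1 + if φ s ∈ M then Real.exp (w s) - 1 else 0) := fun φ => by
    rw [sum_filter, Real.exp_sum]
    exact prod_congr rfl fun s _ => by split_ifs <;> simp
  calc 𝔼 φ : S ≃ A, Real.exp (∑ s with φ s ∈ M, w s)
      ≤ ∏ s, (1 + (Real.exp (w s) - 1) * M.dens) := by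
        simp only [hprod]
        exact expect_equiv_prod_one_add_le M hexp
    _ ≤ ∏ s, Real.exp (M.dens * ((1 + δ) * w s)) := by
        refine prod_le_prod (fun s _ => ?_) fun s _ => ?_
        · have := hexp s
          positivity
        · have hs := exp_sub_one_le_one_add_mul (hw s) (hwδ s) hδ
          calc 1 + (Real.exp (w s) - 1) * (M.dens : ℝ)
              ≤ M.dens * ((1 + δ) * w s) + 1 := by
                rw [add_comm, mul_comm]; gcongr
            _ ≤ _ := Real.add_one_le_exp _
    _ = Real.exp (M.dens * ((1 + δ) * ∑ s, w s)) := by rw [← Real.exp_sum, mul_sum, mul_sum]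

end RandomBijection

section FirstMoment

variable {S A B : Type*} [Fintype S] [Fintype A] [Fintype B] [DecidableEq A]

theorem exists_equiv_forall_sum_le [Nonempty (S ≃ A)] (M : B → Finset A) {w : S → ℝ} {δ p τ : ℝ}
    (hM : ∀ b, ((M b).dens : ℝ) ≤ p) (hδ₀ : 0 ≤ δ) (hδ₁ : δ ≤ 1) (hw : ∀ s, 0 ≤ w s)
    (hwδ : ∀ s, w s ≤ δ)
    (hτ : Fintype.card B * Real.exp (p * ((1 + δ) * ∑ s, w s)) ≤ Real.exp τ) :
    ∃ φ : S ≃ A, ∀ b, ∑ s with φ s ∈ M b, w s ≤ τ := by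
  classical
  have hmean : 𝔼 φ : S ≃ A, ∑ b, Real.exp (∑ s with φ s ∈ M b, w s) ≤ Real.exp τ := by
    rw [expect_sum_comm]
    refine (sum_le_card_nsmul univ _ _ fun b _ => ?_).trans (by rwa [card_univ, nsmul_eq_mul])
    refine (expect_equiv_exp_sum_le (M b) hδ₁ hw hwδ).trans ?_
    have := sum_nonneg fun s (_ : s ∈ univ) => hw s
    gcongr
    exact hM b
  obtain ⟨φ, -, hφ⟩ := exists_le_of_expect_le univ_nonempty hmean
  refine ⟨φ, fun b => Real.exp_le_exp.1 (le_trans ?_ hφ)⟩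
  exact single_le_sum (f := fun b => Real.exp (∑ s with φ s ∈ M b, w s))
    (fun b _ => (Real.exp_pos _).le) (mem_univ b)

theorem exists_equiv_forall_sum_le_half [Nonempty (S ≃ A)] (hB : 1 < Fintype.card B)
    (M : B → Finset A) {ε D : ℝ} (hε : 0 < ε) (hD : 0 < D)
    (hM : ∀ b, ((M b).dens : ℝ) ≤ 1 / 2 - ε) {d : S → ℝ} (hd₀ : ∀ s, 0 ≤ d s)
    (hd : ∀ s, d s ≤ ε ^ 2 / 2 * (D / Real.log (Fintype.card B))) (hsum : ∑ s, d s ≤ D) :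
    ∃ φ : S ≃ A, ∀ b, ∑ s with φ s ∈ M b, d s ≤ D / 2 := by
  set L := Real.log (Fintype.card B) with hL
  have hB₀ : (0 : ℝ) < Fintype.card B := by exact_mod_cast hB.pos
  have hL₀ : 0 < L := Real.log_pos (by exact_mod_cast hB)
  have hp : 0 ≤ 1 / 2 - ε := by
    obtain ⟨b⟩ : Nonempty B := Fintype.card_pos_iff.1 hB.pos
    exact (NNRat.cast_nonneg _).trans (hM b)
  -- The largest scaling for which the hypothesis on `d` bounds the weights `r * d s` by `ε`.
  set r := 2 * L / (ε * D) with hr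
  have hr₀ : 0 < r := by positivity
  have hrd : ∀ s, r * d s ≤ ε := fun s => by
    calc r * d s ≤ r * (ε ^ 2 / 2 * (D / L)) := by gcongr; exact hd s
      _ = ε := by rw [hr]; field_simp
  have hexponent : L + (1 / 2 - ε) * ((1 + ε) * (r * D)) ≤ r * D / 2 := by
    have hrD : r * D = 2 * L / ε := by rw [hr]; field_simp
    have hgain : r * D / 2 - (1 / 2 - ε) * ((1 + ε) * (r * D)) = L + 2 * ε * L := by
      rw [hrD]; field_simp; ring
    nlinarith [mul_pos hε hL₀]
  obtain ⟨φ, hφ⟩ := exists_equiv_forall_sum_le M (w := fun s => r * d s) (τ := r * D / 2) hM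
    hε.le (by linarith) (fun s => mul_nonneg hr₀.le (hd₀ s)) hrd <| by
      rw [← mul_sum, ← Real.exp_log hB₀, ← hL, ← Real.exp_add, Real.exp_le_exp]
      exact le_trans (by gcongr) hexponent
  refine ⟨φ, fun b => le_of_mul_le_mul_left ?_ hr₀⟩
  rw [mul_sum, ← mul_div_assoc]
  exact hφ b

end FirstMoment

theorem exists_injective_forall_rel_of_card_le_add {T B : Type*} [Fintype T] [Fintype B]
    (hTB : Fintype.card T ≤ Fintype.card B) (Q : T → B → Prop) [∀ t b, Decidable (Q t b)]
    (hQ : ∀ t b, Fintype.card T ≤ #{b' | Q t b'} + #{t' | Q t' b}) :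
    ∃ ψ : T → B, Function.Injective ψ ∧ ∀ t, Q t (ψ t) := by
  classical
  let N : T → Finset B := fun t => {b | Q t b}
  have hHall : ∀ X : Finset T, #X ≤ #(X.biUnion N) := fun X => by
    rcases X.eq_empty_or_nonempty with rfl | ⟨t, ht⟩
    · simp
    rcases le_or_gt #X #(N t) with hX | hX
    · exact hX.trans (card_le_card (subset_biUnion_of_mem N ht))
    have hall : X.biUnion N = univ := eq_univ_of_forall fun b => by
      have hmeet : ¬ Disjoint X ({t' | Q t' b} : Finset T) := fun hdisj => by
        have hle := card_le_univ (X ∪ ({t' | Q t' b} : Finset T))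
        rw [card_union_of_disjoint hdisj] at hle
        have htb : Fintype.card T ≤ #(N t) + #{t' | Q t' b} := hQ t b
        lia
      obtain ⟨t', ht', hb⟩ := not_disjoint_iff.1 hmeet
      exact mem_biUnion.2 ⟨t', ht', (mem_filter_univ b).2 ((mem_filter_univ t').1 hb)⟩
    rw [hall, card_univ]
    exact (card_le_univ X).trans hTB
  obtain ⟨ψ, hψ, hmem⟩ := (all_card_le_biUnion_card_iff_exists_injective N).1 hHall
  exact ⟨ψ, hψ, fun t => (mem_filter_univ (ψ t)).1 (hmem t)⟩

section StarSystem

variable {S T A B : Type*} [Fintype S] {E : S → T → Prop} {R : A → B → Prop}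
  [∀ s t, Decidable (E s t)] [∀ a b, Decidable (R a b)]

theorem le_card_forall_rel [Fintype B] (φ : S → A) {t : T} {k : ℝ} (ht : #{s | E s t} ≤ 1)
    (hB : k ≤ Fintype.card B) (hR : ∀ a, k ≤ #{b | R a b}) :
    k ≤ #{b | ∀ s, E s t → R (φ s) b} := by
  by_cases hs : ∃ s, E s t
  · obtain ⟨s, hs⟩ := hs
    have huniq : ∀ s', E s' t → s' = s := fun s' hs' =>
      card_le_one.1 ht s' ((mem_filter_univ s').2 hs') s ((mem_filter_univ s).2 hs)
    refine (hR (φ s)).trans (Nat.cast_le.2 (card_le_card fun b hb => ?_))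
    exact (mem_filter_univ b).2 fun s' hs' => huniq s' hs' ▸ (mem_filter_univ b).1 hb
  · push Not at hs
    simpa [hs] using hB

theorem card_le_card_forall_rel_add_sum [Fintype T] (φ : S → A) (b : B) :
    Fintype.card T ≤ #{t | ∀ s, E s t → R (φ s) b} + ∑ s with ¬ R (φ s) b, #{t | E s t} := by
  classical
  rw [← card_univ, ← card_filter_add_card_filter_not fun t => ∀ s, E s t → R (φ s) b]
  gcongr
  refine (card_le_card fun t ht => ?_).trans card_biUnion_le
  simpa [and_comm] using ht

theorem exists_equiv_injective_forall_rel [Fintype T] [Fintype A] [Fintype B] [Nonempty T]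
    (hSA : Fintype.card S = Fintype.card A) (hTB : Fintype.card T ≤ Fintype.card B)
    (hB : 1 < Fintype.card B) {ε : ℝ} (hε : 0 < ε)
    (hRA : ∀ a, (Fintype.card T : ℝ) / 2 ≤ #{b | R a b})
    (hRB : ∀ b, 1 / 2 + ε ≤ (dens {a | R a b} : ℝ))
    (hES : ∀ s, (#{t | E s t} : ℝ) ≤ ε ^ 2 / 2 * (Fintype.card T / Real.log (Fintype.card B)))
    (hET : ∀ t, #{s | E s t} ≤ 1) :
    ∃ (φ : S ≃ A) (ψ : T → B), Function.Injective ψ ∧ ∀ s t, E s t → R (φ s) (ψ t) := by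
  classical
  have : Nonempty (S ≃ A) := ⟨Fintype.equivOfCardEq hSA⟩
  have hT : (0 : ℝ) < Fintype.card T := Nat.cast_pos.2 Fintype.card_pos
  have hTB' : (Fintype.card T : ℝ) ≤ Fintype.card B := Nat.cast_le.2 hTB
  have hM : ∀ b, (dens {a | ¬ R a b} : ℝ) ≤ 1 / 2 - ε := fun b => by
    have hle : dens {a | R a b} + dens {a | ¬ R a b} ≤ 1 :=
      (dens_filter_add_dens_filter_not_eq_dens _).trans_le dens_le_one
    have hle' : (dens {a | R a b} : ℝ) + dens {a | ¬ R a b} ≤ 1 := by exact_mod_cast hle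
    linarith [hRB b]
  have hsum : ∑ s, (#{t | E s t} : ℝ) ≤ Fintype.card T := by
    have hcount : ∑ s, #{t | E s t} = ∑ t, #{s | E s t} :=
      sum_card_bipartiteAbove_eq_sum_card_bipartiteBelow E
    have hle : ∑ t, #{s | E s t} ≤ Fintype.card T := by
      simpa using sum_le_card_nsmul univ _ 1 fun t _ => hET t
    exact_mod_cast hcount.trans_le hle
  obtain ⟨φ, hφ⟩ := exists_equiv_forall_sum_le_half hB (fun b => {a | ¬ R a b}) hε hT hM
    (fun s => Nat.cast_nonneg _) hES hsum
  obtain ⟨ψ, hψ, hQ⟩ := exists_injective_forall_rel_of_card_le_add hTB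
    (fun t b => ∀ s, E s t → R (φ s) b) fun t b => by
      have ht := le_card_forall_rel φ (hET t) (by linarith) hRA
      have hb : (Fintype.card T : ℝ) ≤ #{t | ∀ s, E s t → R (φ s) b} +
          ∑ s with ¬ R (φ s) b, (#{t | E s t} : ℝ) := by
        exact_mod_cast card_le_card_forall_rel_add_sum (E := E) (R := R) φ b
      have hbad : ∑ s with ¬ R (φ s) b, (#{t | E s t} : ℝ) ≤ Fintype.card T / 2 := by
        simpa only [mem_filter_univ] using hφ b
      rify
      linarith
  exact ⟨φ, ψ, hψ, fun s t => hQ t s⟩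

end StarSystem

namespace IsBigraph

variable {V W : Type*} {G : SimpleGraph V} {A B : Finset V} {H : SimpleGraph W} {S T : Finset W}

theorem symm (h : IsBigraph G A B) : IsBigraph G B A :=
  ⟨h.1.symm, by rw [Set.union_comm]; exact h.2⟩

theorem card_filter_adj [Fintype V] [DecidableRel G.Adj] (h : IsBigraph G A B) {x : V}
    (hx : x ∈ A) : #{y : B | G.Adj x y} = G.degree x := by
  rw [← G.card_neighborFinset_eq_degree,
    SimpleGraph.isBipartiteWith_neighborFinset h.1 (mem_coe.2 hx), ← card_map (.subtype _)]
  congr 1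
  ext y
  simp [and_comm]

theorem adj_induction (h : IsBigraph G A B) {P : V → V → Prop}
    (hsymm : ∀ x y, P x y → P y x) (hAB : ∀ a ∈ A, ∀ b ∈ B, G.Adj a b → P a b) {x y : V}
    (hxy : G.Adj x y) : P x y := by
  rcases h.1.mem_of_adj hxy with ⟨hx, hy⟩ | ⟨hx, hy⟩
  · exact hAB x hx y hy hxy
  · exact hsymm y x (hAB y hy x hx hxy.symm)

/-- The vertex set of a bipartite graph as the disjoint union of its classes; it reduces the
construction of a map that respects the classes to one map per class. -/
noncomputable def sumEquiv (h : IsBigraph G A B) : A ⊕ B ≃ V :=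
  Equiv.ofBijective (Sum.elim (↑) (↑)) ⟨
    Subtype.val_injective.sumElim Subtype.val_injective fun a b =>
      (Set.disjoint_left.1 h.1.disjoint a.2 <| · ▸ b.2),
    fun x => (h.2 ▸ Set.mem_univ x : x ∈ (A : Set V) ∪ B).elim
      (fun hx => ⟨.inl ⟨x, hx⟩, rfl⟩) fun hx => ⟨.inr ⟨x, hx⟩, rfl⟩⟩

theorem sumEquiv_symm_left (h : IsBigraph G A B) {a : V} (ha : a ∈ A) :
    h.sumEquiv.symm a = .inl ⟨a, ha⟩ :=
  h.sumEquiv.symm_apply_eq.2 rfl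

theorem sumEquiv_symm_right (h : IsBigraph G A B) {b : V} (hb : b ∈ B) :
    h.sumEquiv.symm b = .inr ⟨b, hb⟩ :=
  h.sumEquiv.symm_apply_eq.2 rfl

theorem isBipartiteSubgraph_of_injective (hG : IsBigraph G A B) (hH : IsBigraph H S T)
    {φ : S → A} {ψ : T → B} (hφ : Function.Injective φ) (hψ : Function.Injective ψ)
    (hadj : ∀ (s : S) (t : T), H.Adj s t → G.Adj (φ s) (ψ t)) :
    IsBipartiteSubgraph H S T G A B := by
  let f : W → V := hG.sumEquiv ∘ Sum.map φ ψ ∘ hH.sumEquiv.symm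
  have hfS : ∀ s (hs : s ∈ S), f s = φ ⟨s, hs⟩ := fun s hs =>
    congrArg (hG.sumEquiv ∘ Sum.map φ ψ) (hH.sumEquiv_symm_left hs)
  have hfT : ∀ t (ht : t ∈ T), f t = ψ ⟨t, ht⟩ := fun t ht =>
    congrArg (hG.sumEquiv ∘ Sum.map φ ψ) (hH.sumEquiv_symm_right ht)
  have hf : Function.Injective f :=
    hG.sumEquiv.injective.comp ((hφ.sumMap hψ).comp hH.sumEquiv.symm.injective)
  have hf_adj : ∀ x y, H.Adj x y → G.Adj (f x) (f y) := fun x y =>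
    hH.adj_induction (P := fun x y => G.Adj (f x) (f y)) (fun _ _ => .symm) fun s hs t ht hst => by
      rw [hfS s hs, hfT t ht]
      exact hadj ⟨s, hs⟩ ⟨t, ht⟩ hst
  exact ⟨⟨⟨f, hf_adj _ _⟩, hf⟩, fun s hs => (hfS s hs ▸ (φ ⟨s, hs⟩).2 : f s ∈ A),
    fun t ht => (hfT t ht ▸ (ψ ⟨t, ht⟩).2 : f t ∈ B)⟩

theorem exists_equiv_fin_sum_fin (h : IsBigraph G A B) {m n : ℕ} (hA : #A = m) (hB : #B = n) :
    ∃ e : V ≃ Fin m ⊕ Fin n, (∀ a ∈ A, (e a).isLeft) ∧ ∀ b ∈ B, (e b).isRight :=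
  ⟨h.sumEquiv.symm.trans (.sumCongr (A.equivFinOfCardEq hA) (B.equivFinOfCardEq hB)),
    fun a ha => by simp [h.sumEquiv_symm_left ha], fun b hb => by simp [h.sumEquiv_symm_right hb]⟩

theorem completeBipartiteGraph_adj (h : IsBigraph G A B) {α β : Type*} {e : V → α ⊕ β}
    (hA : ∀ a ∈ A, (e a).isLeft) (hB : ∀ b ∈ B, (e b).isRight) {x y : V} (hxy : G.Adj x y) :
    (completeBipartiteGraph α β).Adj (e x) (e y) :=
  h.adj_induction (P := fun x y => (completeBipartiteGraph α β).Adj (e x) (e y))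
    (fun _ _ => .symm) (fun a ha b hb _ => .inl ⟨hA a ha, hB b hb⟩) hxy

theorem bipartiteCompl (h : IsBigraph G A B) : IsBigraph (bipartiteCompl G A B) A B :=
  ⟨⟨h.1.disjoint, fun _ _ hxy => hxy.1.2.imp id And.symm⟩, h.2⟩

end IsBigraph

theorem IsBipartiteSubgraph.bipartitePack_bipartiteCompl {V W : Type*} {G : SimpleGraph V}
    {A B : Finset V} {H : SimpleGraph W} {S T : Finset W} {m n : ℕ}
    (h : IsBipartiteSubgraph H S T G A B) (hG : IsBigraph G A B) (hH : IsBigraph H S T)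
    (hA : #A = m) (hB : #B = n) : BipartitePack H S T (bipartiteCompl G A B) A B m n := by
  obtain ⟨f, hfS, hfT⟩ := h
  obtain ⟨e, heA, heB⟩ := hG.exists_equiv_fin_sum_fin hA hB
  have heS : ∀ s ∈ S, (e (f s)).isLeft := fun s hs => heA _ (hfS s hs)
  have heT : ∀ t ∈ T, (e (f t)).isRight := fun t ht => heB _ (hfT t ht)
  refine ⟨⟨⟨e ∘ f, hH.completeBipartiteGraph_adj heS heT⟩, e.injective.comp f.injective⟩,
    ⟨⟨e, hG.bipartiteCompl.completeBipartiteGraph_adj heA heB⟩, e.injective⟩,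
    heS, heT, heA, heB, fun x y x' y' hxy hxy' heq => ?_⟩
  have hedge : s(f x, f y) = s(x', y') := Sym2.map.injective e.injective heq
  have hadj : s(f x, f y) ∈ G.edgeSet := f.toHom.map_adj hxy
  exact hxy'.2 (G.mem_edgeSet.1 (hedge ▸ hadj))

end BipartitePacking

theorem theorem1_general {V W : Type*} [Fintype V] [Fintype W] {G : SimpleGraph V}
    [DecidableRel G.Adj] {A B : Finset V} {H : SimpleGraph W} [DecidableRel H.Adj]
    {S T : Finset W} {n : ℕ} {ε : ℝ} (hn : 1 < n) (hε : 0 < ε)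
    (hG : BipartitePacking.IsBigraph G A B) (hH : BipartitePacking.IsBigraph H S T)
    (hA : A.card = n) (hB : B.card = n) (hS : S.card = n) (hT : T.card = n)
    (hGdeg : ∀ x, x ∈ A ∨ x ∈ B → (1 / 2 + ε) * n ≤ G.degree x)
    (hSdeg : ∀ s ∈ S, (H.degree s : ℝ) ≤ ε ^ 2 / 2 * (n / Real.log n))
    (hTdeg : ∀ t ∈ T, H.degree t ≤ 1) :
    BipartitePacking.IsBipartiteSubgraph H S T G A B ∧
      BipartitePacking.BipartitePack H S T (BipartitePacking.bipartiteCompl G A B) A B n n := by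
  have hn₀ : (0 : ℝ) < n := Nat.cast_pos.2 hn.pos
  have : Nonempty T := (Finset.card_pos.1 (hT ▸ hn.pos)).to_subtype
  obtain ⟨φ, ψ, hψ, hadj⟩ := BipartitePacking.exists_equiv_injective_forall_rel
    (S := S) (T := T) (A := A) (B := B) (E := fun s t => H.Adj s t) (R := fun a b => G.Adj a b)
    (by simp [hS, hA]) (by simp [hT, hB]) (by simpa [hB]) hε
    (fun a => by
      rw [hG.card_filter_adj a.2, Fintype.card_coe, hT]
      nlinarith [hGdeg a (.inl a.2)])
    (fun b => by
      simp only [G.adj_comm _ (b : V)]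
      rw [Finset.nnratCast_dens, hG.symm.card_filter_adj b.2, Fintype.card_coe, hA, le_div_iff₀ hn₀]
      exact hGdeg b (.inr b.2))
    (fun s => by
      rw [hH.card_filter_adj s.2, Fintype.card_coe, Fintype.card_coe, hT, hB]
      exact hSdeg s s.2)
    (fun t => by
      simp only [H.adj_comm _ (t : W)]
      rw [hH.symm.card_filter_adj t.2]
      exact hTdeg t t.2)
  have hsub := hG.isBipartiteSubgraph_of_injective hH φ.injective hψ hadj
  exact ⟨hsub, hsub.bipartitePack_bipartiteCompl hG hH hA hB⟩

theorem theorem1 (ε : ℝ) (hε0 : 0 < ε) (hε1 : ε < 1 / 2) :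
    ∃ n₀ : ℕ, ∀ n : ℕ, n₀ < n →
      ∀ (V : Type*) [Fintype V] (W : Type*) [Fintype W]
        (G : SimpleGraph V) [DecidableRel G.Adj] (A B : Finset V)
        (H : SimpleGraph W) [DecidableRel H.Adj] (S T : Finset W),
        BipartitePacking.IsBigraph G A B → BipartitePacking.IsBigraph H S T →
        A.card = n → B.card = n → S.card = n → T.card = n →
        (∀ x, x ∈ A ∨ x ∈ B → (1 / 2 + ε) * (n : ℝ) < (G.degree x : ℝ)) →
        (∀ x ∈ S, (H.degree x : ℝ) < ε ^ 4 / 100 * ((n : ℝ) / Real.log n)) →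
        (∀ y ∈ T, H.degree y = 1) →
        BipartitePacking.IsBipartiteSubgraph H S T G A B ∧
        BipartitePacking.BipartitePack H S T
          (BipartitePacking.bipartiteCompl G A B) A B n n := by
  have hconst : ε ^ 4 / 100 ≤ ε ^ 2 / 2 := by
    linarith [pow_le_pow_of_le_one hε0.le (by linarith) (show 2 ≤ 4 by norm_num), sq_nonneg ε]
  exact ⟨1, fun n hn V _ W _ G _ A B H _ S T hG hH hA hB hS hT hGdeg hSdeg hTdeg =>
    theorem1_general hn hε0 hG hH hA hB hS hT (fun x hx => (hGdeg x hx).le)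
      (fun s hs => (hSdeg s hs).le.trans (by gcongr)) fun t ht => (hTdeg t ht).le⟩
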